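/- Terminology. Composition is written $g\circ f$. A \emph{disjunctive relevant category} is a symmetric monoidal category $(\mathcal C,\otimes,I,a,l,r,c)$ with a natural transformation with components $\nabla_A\colon A\otimes A\to A$ such that $\nabla_A\circ(\nabla_A\otimes 1_A)=\nabla_A\circ(1_A\otimes\nabla_A)\circ a_{A,A,A}$, $\;\nabla_I\circ l_I^{-1}=1_I$, $\;\nabla_A\circ c_{A,A}=\nabla_A$, and $\nabla_{A\otimes B}=(\nabla_A\otimes\nabla_B)\circ c^m_{A,B,A,B}$, where $c^m_{A,B,C,D}\colon(A\otimes B)\otimes(C\otimes D)\to(A\otimes C)\otimes(B\otimes D)$ is the canonical arrow built from $a$, $a^{-1}$ and $c_{B,C}$. A \emph{disjunctive relevant endofunctor} in it is an endofunctor $E$ with a natural transformation $\psi_{A,B}\colon EA\otimes EB\to E(A\otimes B)$ and an arrow $\psi_0\colon I\to EI$ that make $E$ a symmetric (lax) monoidal functor and satisfy $E\nabla_A\circ\psi_{A,A}=\nabla_{EA}$. A \emph{cocartesian category} is a disjunctive relevant category in which $I$ is an initial object, with unique arrows $!_A\colon I\to A$, and $\nabla_A\circ(1_A\otimes{!_A})\circ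 r_A^{-1}=1_A$; equivalently, $I$ and $\otimes$ are a chosen initial object and chosen binary coproducts. Given a set $P$ of generating objects and a family $(E^i)_{i\in\mathcal I}$ of generating functors, let $\mathcal D$ be the free cocartesian category with a family of (arbitrary) endofunctors. Its objects are the formulae built from the elements of $P$ and $I$ with $\otimes$ and the unary connectives $E^i$; its arrows are the equivalence classes of arrow terms built from $1_A$, $a_{A,B,C}$, $a^{-1}_{A,B,C}$, $l_A$, $l_A^{-1}$, $r_A$, $r_A^{-1}$, $c_{A,B}$, $\nabla_A$, $!_A$ with $\circ$, $\otimes$ and $E^i$, modulo the congruence generated by the equations of cocartesian categories and the functorial equations of each $E^i$. Let $\mathit{Fun}$ be the category of functions between finite ordinals, and let $G\colon\mathcal D\to\mathit{Fun}$ be the following functor: $GA$ is the number of occurrences of generators (objects and functors) in $A$; $G$ sends $1_A$, $a$, $l$, $r$ and the inverses to identity functions; $Gc_{A,B}$ interchanges the block of $GA$ elements with the block of $GB$ elements; $G\nabla_A\colon GA+GA\to GA$ identifies the two copies of $GA$; $G{!_A}$ is the empty function; $G(f\otimes g)$ is $Gf$ followed on the right by $Gg$; $G(E^if)$ is $Gf$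 with a new first element sent to the new first element; and $G(g\circ f)=Gg\circ Gf$. \textbf{Theorem.} (1) ($\mathcal D$-Coherence.) For all $P$ and $\mathcal I$, the functor $G\colon\mathcal D\to\mathit{Fun}$ is faithful. (2) Every endofunctor $E$ of a cocartesian category is a disjunctive relevant endofunctor with \[ \psi_{A,B}=\nabla_{E(A\otimes B)}\circ\bigl(E((1_A\otimes{!_B})\circ r_A^{-1})\otimes E(({!_A}\otimes 1_B)\circ l_B^{-1})\bigr),\qquad \psi_0={!_{EI}}, \] and moreover $E\,{!_A}\circ\psi_0={!_{EA}}$ for every object $A$. -/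

import Mathlib

open CategoryTheory MonoidalCategory

universe v u

/-! ### Disjunctive relevant and cocartesian categories -/

/-- A disjunctive relevant category: a symmetric monoidal category with a codiagonal natural
transformation satisfying the duals of the coherence equations of a diagonal.
Mathlib's `tensorμ A B A B : (A ⊗ B) ⊗ (A ⊗ B) ⟶ (A ⊗ A) ⊗ (B ⊗ B)` exchanges the two
middle factors. -/
class DisjunctiveRelevantCategory (C : Type u) [Category.{v} C] [MonoidalCategory C]
    [SymmetricCategory C] where
  /-- the codiagonal `∇_A` -/
  nabla (A : C) : A ⊗ A ⟶ A
  nabla_naturality {A B : C} (f : A ⟶ B) : (f ⊗ₘ f) ≫ nabla B = nabla A ≫ f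
  nabla_assoc (A : C) :
    (nabla A ⊗ₘ 𝟙 A) ≫ nabla A = (α_ A A A).hom ≫ (𝟙 A ⊗ₘ nabla A) ≫ nabla A
  nabla_unit : (λ_ (𝟙_ C)).inv ≫ nabla (𝟙_ C) = 𝟙 (𝟙_ C)
  nabla_braiding (A : C) : (β_ A A).hom ≫ nabla A = nabla A
  nabla_tensor (A B : C) : nabla (A ⊗ B) = tensorμ A B A B ≫ (nabla A ⊗ₘ nabla B)

/-- A cocartesian category: a disjunctive relevant category whose unit object is initial
and in which the initial arrow is neutral for the codiagonal.  The last equation is what makes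
`A ⊗ B` a coproduct of `A` and `B`. -/
class CocartesianCategory (C : Type u) [Category.{v} C] [MonoidalCategory C]
    [SymmetricCategory C] extends DisjunctiveRelevantCategory C where
  unitIsInitial : Limits.IsInitial (𝟙_ C)
  nabla_neutral (A : C) :
    (ρ_ A).inv ≫ (𝟙 A ⊗ₘ unitIsInitial.to A) ≫ nabla A = 𝟙 A

section

variable {C : Type u} [Category.{v} C] [MonoidalCategory C] [SymmetricCategory C]

/-- A disjunctive relevant endofunctor: a linear (that is, symmetric lax monoidal) endofunctor
`E`, with `μ` in the role of `ψ` and `ε` in the role of `ψ₀`, that preserves the codiagonal. -/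
class DisjunctiveRelevantEndofunctor [DisjunctiveRelevantCategory C] (E : C ⥤ C)
    extends E.LaxBraided where
  map_nabla (A : C) :
    Functor.LaxMonoidal.μ E A A ≫ E.map (DisjunctiveRelevantCategory.nabla A) =
      DisjunctiveRelevantCategory.nabla (E.obj A)

namespace CocartesianCategory

variable [CocartesianCategory C]

/-- The codiagonal `∇_A : A ⊗ A ⟶ A`. -/
abbrev codiag (A : C) : A ⊗ A ⟶ A := DisjunctiveRelevantCategory.nabla A

/-- The unique arrow `!_A : I ⟶ A`. -/
def bang (A : C) : 𝟙_ C ⟶ A := unitIsInitial.to A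

/-- `ψ_{A,B} = ∇_{E(A⊗B)} ∘ (E((1_A ⊗ !_B) ∘ r_A⁻¹) ⊗ E((!_A ⊗ 1_B) ∘ l_B⁻¹))`. -/
def psi (E : C ⥤ C) (A B : C) : E.obj A ⊗ E.obj B ⟶ E.obj (A ⊗ B) :=
  (E.map ((ρ_ A).inv ≫ (𝟙 A ⊗ₘ bang B)) ⊗ₘ E.map ((λ_ B).inv ≫ (bang A ⊗ₘ 𝟙 B))) ≫
    codiag (E.obj (A ⊗ B))

/-- `ψ₀ = !_{EI}`. -/
def psiZero (E : C ⥤ C) : 𝟙_ C ⟶ E.obj (𝟙_ C) := bang (E.obj (𝟙_ C))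

end CocartesianCategory

end

/-! ### The free cocartesian category with a family of endofunctors -/

namespace FreeCocartesian

/-- Propositional formulae built from the generating objects in `P`, the nullary connective
`I`, the binary connective `⊗` and a unary connective `Eⁱ` for every `i : ι`. -/
inductive Formula (P : Type u) (ι : Type v) : Type (max u v)
  | letter (p : P) : Formula P ι
  | unit : Formula P ι
  | tensor (A B : Formula P ι) : Formula P ι
  | app (i : ι) (A : Formula P ι) : Formula P ι

variable {P : Type u} {ι : Type v}

/-- Arrow terms; `comp f g` is `g ∘ f`. -/
inductive Term : Formula P ι → Formula P ι → Type (max u v)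
  | id (A : Formula P ι) : Term A A
  | comp {A B D : Formula P ι} (f : Term A B) (g : Term B D) : Term A D
  | tensor {A B A' B' : Formula P ι} (f : Term A B) (g : Term A' B') :
      Term (.tensor A A') (.tensor B B')
  | app (i : ι) {A B : Formula P ι} (f : Term A B) : Term (.app i A) (.app i B)
  | a (A B D : Formula P ι) : Term (.tensor (.tensor A B) D) (.tensor A (.tensor B D))
  | aInv (A B D : Formula P ι) : Term (.tensor A (.tensor B D)) (.tensor (.tensor A B) D)
  | l (A : Formula P ι) : Term (.tensor .unit A) A
  | lInv (A : Formula P ι) : Term A (.tensor .unit A)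
  | r (A : Formula P ι) : Term (.tensor A .unit) A
  | rInv (A : Formula P ι) : Term A (.tensor A .unit)
  | c (A B : Formula P ι) : Term (.tensor A B) (.tensor B A)
  | nabla (A : Formula P ι) : Term (.tensor A A) A
  | bang (A : Formula P ι) : Term .unit A

/-- The arrow term `c^m_{A,B,D,F} : (A ⊗ B) ⊗ (D ⊗ F) ⟶ (A ⊗ D) ⊗ (B ⊗ F)`. -/
def Term.cm (A B D F : Formula P ι) :
    Term (.tensor (.tensor A B) (.tensor D F)) (.tensor (.tensor A D) (.tensor B F)) :=
  .comp (.a A B (.tensor D F))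
    (.comp
      (.tensor (.id A)
        (.comp (.aInv B D F) (.comp (.tensor (.c B D) (.id F)) (.a D B F))))
      (.aInv A D (.tensor B F)))

/-- Equality of arrow terms: the least congruence containing the equations of cocartesian
categories and the functorial equations of every `Eⁱ`. -/
inductive Eqv : {A B : Formula P ι} → Term A B → Term A B → Prop
  -- congruence
  | refl {A B} (f : Term A B) : Eqv f f
  | symm {A B} {f g : Term A B} : Eqv f g → Eqv g f
  | trans {A B} {f g h : Term A B} : Eqv f g → Eqv g h → Eqv f h
  | comp {A B D} {f f' : Term A B} {g g' : Term B D} :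
      Eqv f f' → Eqv g g' → Eqv (.comp f g) (.comp f' g')
  | tensor {A B A' B'} {f f' : Term A B} {g g' : Term A' B'} :
      Eqv f f' → Eqv g g' → Eqv (.tensor f g) (.tensor f' g')
  | app (i : ι) {A B} {f f' : Term A B} : Eqv f f' → Eqv (.app i f) (.app i f')
  -- category
  | id_comp {A B} (f : Term A B) : Eqv (.comp (.id A) f) f
  | comp_id {A B} (f : Term A B) : Eqv (.comp f (.id B)) f
  | comp_assoc {A B D F} (f : Term A B) (g : Term B D) (h : Term D F) :
      Eqv (.comp (.comp f g) h) (.comp f (.comp g h))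
  -- functoriality of `⊗`
  | tensor_id (A B : Formula P ι) : Eqv (.tensor (.id A) (.id B)) (.id (.tensor A B))
  | tensor_comp {A B D A' B' D'} (f : Term A B) (g : Term B D) (f' : Term A' B')
      (g' : Term B' D') :
      Eqv (.tensor (.comp f g) (.comp f' g')) (.comp (.tensor f f') (.tensor g g'))
  -- functoriality of `Eⁱ`
  | app_id (i : ι) (A : Formula P ι) : Eqv (.app i (.id A)) (.id (.app i A))
  | app_comp (i : ι) {A B D} (f : Term A B) (g : Term B D) :
      Eqv (.app i (.comp f g)) (.comp (.app i f) (.app i g))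
  -- `a`, `l`, `r` are natural isomorphisms
  | a_naturality {A B A' B' A'' B''} (f : Term A B) (g : Term A' B') (h : Term A'' B'') :
      Eqv (.comp (.tensor (.tensor f g) h) (.a B B' B''))
        (.comp (.a A A' A'') (.tensor f (.tensor g h)))
  | a_aInv (A B D : Formula P ι) : Eqv (.comp (.a A B D) (.aInv A B D)) (.id _)
  | aInv_a (A B D : Formula P ι) : Eqv (.comp (.aInv A B D) (.a A B D)) (.id _)
  | l_naturality {A B} (f : Term A B) :
      Eqv (.comp (.tensor (.id .unit) f) (.l B)) (.comp (.l A) f)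
  | l_lInv (A : Formula P ι) : Eqv (.comp (.l A) (.lInv A)) (.id _)
  | lInv_l (A : Formula P ι) : Eqv (.comp (.lInv A) (.l A)) (.id _)
  | r_naturality {A B} (f : Term A B) :
      Eqv (.comp (.tensor f (.id .unit)) (.r B)) (.comp (.r A) f)
  | r_rInv (A : Formula P ι) : Eqv (.comp (.r A) (.rInv A)) (.id _)
  | rInv_r (A : Formula P ι) : Eqv (.comp (.rInv A) (.r A)) (.id _)
  -- pentagon and triangle
  | pentagon (A B D F : Formula P ι) :
      Eqv (.comp (.tensor (.a A B D) (.id F))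
            (.comp (.a A (.tensor B D) F) (.tensor (.id A) (.a B D F))))
        (.comp (.a (.tensor A B) D F) (.a A B (.tensor D F)))
  | triangle (A B : Formula P ι) :
      Eqv (.comp (.a A .unit B) (.tensor (.id A) (.l B))) (.tensor (.r A) (.id B))
  -- symmetry
  | c_naturality {A B A' B'} (f : Term A B) (g : Term A' B') :
      Eqv (.comp (.tensor f g) (.c B B')) (.comp (.c A A') (.tensor g f))
  | c_c (A B : Formula P ι) : Eqv (.comp (.c A B) (.c B A)) (.id _)
  | hexagon (A B D : Formula P ι) :
      Eqv (.comp (.a A B D) (.comp (.c A (.tensor B D)) (.a B D A)))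
        (.comp (.tensor (.c A B) (.id D))
          (.comp (.a B A D) (.tensor (.id B) (.c A D))))
  -- codiagonal
  | nabla_naturality {A B} (f : Term A B) :
      Eqv (.comp (.tensor f f) (.nabla B)) (.comp (.nabla A) f)
  | nabla_a (A : Formula P ι) :
      Eqv (.comp (.tensor (.nabla A) (.id A)) (.nabla A))
        (.comp (.a A A A) (.comp (.tensor (.id A) (.nabla A)) (.nabla A)))
  | nabla_l : Eqv (.comp (.lInv .unit) (.nabla .unit)) (.id .unit)
  | nabla_c (A : Formula P ι) : Eqv (.comp (.c A A) (.nabla A)) (.nabla A)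
  | nabla_ac (A B : Formula P ι) :
      Eqv (.nabla (.tensor A B)) (.comp (.cm A B A B) (.tensor (.nabla A) (.nabla B)))
  -- the unit is initial, and neutral for the codiagonal
  | bang_unique {A : Formula P ι} (f : Term .unit A) : Eqv f (.bang A)
  | nabla_bang (A : Formula P ι) :
      Eqv (.comp (.rInv A) (.comp (.tensor (.id A) (.bang A)) (.nabla A))) (.id A)

instance termSetoid (A B : Formula P ι) : Setoid (Term A B) where
  r := Eqv
  iseqv := ⟨Eqv.refl, Eqv.symm, Eqv.trans⟩

/-- The category `𝓓`: formulae, and arrow terms modulo the equations. -/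
instance : Category (Formula P ι) where
  Hom A B := Quotient (termSetoid A B)
  id A := Quotient.mk _ (.id A)
  comp f g := Quotient.map₂ Term.comp (fun _ _ h _ _ h' => Eqv.comp h h') f g
  id_comp := by rintro A B ⟨f⟩; exact Quotient.sound (.id_comp f)
  comp_id := by rintro A B ⟨f⟩; exact Quotient.sound (.comp_id f)
  assoc := by rintro A B D F ⟨f⟩ ⟨g⟩ ⟨h⟩; exact Quotient.sound (.comp_assoc f g h)

/-- The arrow of `𝓓` named by an arrow term. -/
def Term.toHom {A B : Formula P ι} (f : Term A B) : A ⟶ B := Quotient.mk (termSetoid A B) f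

/-- The generating endofunctor `Eⁱ` of `𝓓`. -/
def appFunctor (i : ι) : Formula P ι ⥤ Formula P ι where
  obj A := .app i A
  map f := Quotient.map (Term.app i) (fun _ _ h => Eqv.app i h) f
  map_id A := Quotient.sound (.app_id i A)
  map_comp := by rintro A B D ⟨f⟩ ⟨g⟩; exact Quotient.sound (.app_comp i f g)

/-- The tensor product of arrows of `𝓓`. -/
def tensorArrow {A B A' B' : Formula P ι} (f : A ⟶ B) (g : A' ⟶ B') :
    Formula.tensor A A' ⟶ Formula.tensor B B' :=
  Quotient.map₂ Term.tensor (fun _ _ h _ _ h' => Eqv.tensor h h') f g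

instance : MonoidalCategoryStruct (Formula P ι) where
  tensorObj := .tensor
  tensorUnit := .unit
  tensorHom := tensorArrow
  whiskerLeft A _ _ f := tensorArrow (𝟙 A) f
  whiskerRight f B := tensorArrow f (𝟙 B)
  associator A B D :=
    ⟨(Term.a A B D).toHom, (Term.aInv A B D).toHom, Quotient.sound (.a_aInv A B D),
      Quotient.sound (.aInv_a A B D)⟩
  leftUnitor A :=
    ⟨(Term.l A).toHom, (Term.lInv A).toHom, Quotient.sound (.l_lInv A),
      Quotient.sound (.lInv_l A)⟩
  rightUnitor A :=
    ⟨(Term.r A).toHom, (Term.rInv A).toHom, Quotient.sound (.r_rInv A),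
      Quotient.sound (.rInv_r A)⟩

instance : MonoidalCategory (Formula P ι) :=
  MonoidalCategory.ofTensorHom
    (id_tensorHom_id := fun A B => Quotient.sound (.tensor_id A B))
    (id_tensorHom := fun _ _ _ _ => rfl)
    (tensorHom_id := fun _ _ => rfl)
    (tensorHom_comp_tensorHom := by
      rintro _ _ _ _ _ _ ⟨f⟩ ⟨f'⟩ ⟨g⟩ ⟨g'⟩
      exact Quotient.sound (.symm (.tensor_comp f g f' g')))
    (associator_naturality := by
      rintro _ _ _ _ _ _ ⟨f⟩ ⟨g⟩ ⟨h⟩; exact Quotient.sound (.a_naturality f g h))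
    (leftUnitor_naturality := by rintro _ _ ⟨f⟩; exact Quotient.sound (.l_naturality f))
    (rightUnitor_naturality := by rintro _ _ ⟨f⟩; exact Quotient.sound (.r_naturality f))
    (pentagon := fun A B D F => Quotient.sound (.pentagon A B D F))
    (triangle := fun A B => Quotient.sound (.triangle A B))

/-- The symmetry isomorphism of `𝓓`. -/
def braidIso (A B : Formula P ι) : A ⊗ B ≅ B ⊗ A :=
  ⟨(Term.c A B).toHom, (Term.c B A).toHom, Quotient.sound (.c_c A B), Quotient.sound (.c_c B A)⟩

theorem hexagon_hom (A B D : Formula P ι) :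
    (α_ A B D).hom ≫ (braidIso A (B ⊗ D)).hom ≫ (α_ B D A).hom =
      ((braidIso A B).hom ▷ D) ≫ (α_ B A D).hom ≫ (B ◁ (braidIso A D).hom) :=
  Quotient.sound (.hexagon A B D)

theorem braidIso_inv (A B : Formula P ι) : (braidIso A B).inv = (braidIso B A).hom := rfl

instance : SymmetricCategory (Formula P ι) where
  braiding := braidIso
  braiding_naturality_right := by
    rintro A _ _ ⟨f⟩; exact Quotient.sound (.c_naturality (.id A) f)
  braiding_naturality_left := by
    rintro _ _ ⟨f⟩ A; exact Quotient.sound (.c_naturality f (.id A))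
  hexagon_forward := hexagon_hom
  hexagon_reverse A B D := by
    have h : α_ D A B ≪≫ braidIso D (A ⊗ B) ≪≫ α_ A B D =
        whiskerRightIso (braidIso D A) B ≪≫ α_ A D B ≪≫ whiskerLeftIso A (braidIso D B) :=
      Iso.ext (hexagon_hom D A B)
    have h' := congrArg Iso.inv h
    simpa [braidIso_inv] using h'
  symmetry A B := (braidIso A B).hom_inv_id

instance : CocartesianCategory (Formula P ι) where
  nabla A := (Term.nabla A).toHom
  nabla_naturality := by rintro _ _ ⟨f⟩; exact Quotient.sound (.nabla_naturality f)
  nabla_assoc A := Quotient.sound (.nabla_a A)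
  nabla_unit := Quotient.sound .nabla_l
  nabla_braiding A := Quotient.sound (.nabla_c A)
  nabla_tensor A B := by
    have h : (Term.cm A B A B).toHom = tensorμ A B A B := by
      have h' : (Term.cm A B A B).toHom = (α_ A B (A ⊗ B)).hom ≫
          (A ◁ ((α_ B A B).inv ≫ ((β_ B A).hom ▷ B) ≫ (α_ A B B).hom)) ≫
            (α_ A A (B ⊗ B)).inv := rfl
      rw [h', tensorμ]
      simp
    rw [← h]
    exact Quotient.sound (.nabla_ac A B)
  unitIsInitial := Limits.IsInitial.ofUniqueHom (fun A => (Term.bang A).toHom)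
    (by rintro A ⟨f⟩; exact Quotient.sound (.bang_unique f))
  nabla_neutral A := Quotient.sound (.nabla_bang A)

/-! ### The graph functor -/

/-- The number of occurrences of generators (objects and functors) in a formula. -/
def Formula.count : Formula P ι → ℕ
  | letter _ => 1
  | unit => 0
  | tensor A B => A.count + B.count
  | app _ A => A.count + 1

/-- `f` and `g` side by side. -/
def par {m n m' n' : ℕ} (f : Fin m → Fin n) (g : Fin m' → Fin n') :
    Fin (m + m') → Fin (n + n') :=
  Fin.addCases (fun x => Fin.castAdd n' (f x)) (fun x => Fin.natAdd n (g x))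

/-- A new first element, sent to the new first element, followed by `f`. -/
def bump {m n : ℕ} (f : Fin m → Fin n) : Fin (m + 1) → Fin (n + 1) :=
  Fin.cases 0 (fun x => Fin.succ (f x))

/-- The crossing of a block of `m` elements with a block of `n` elements. -/
def swap (m n : ℕ) : Fin (m + n) → Fin (n + m) :=
  Fin.addCases (fun x => Fin.natAdd n x) (fun x => Fin.castAdd m x)

/-- The function identifying two consecutive blocks of `n` elements. -/
def fold (n : ℕ) : Fin (n + n) → Fin n :=
  Fin.addCases (fun x => x) (fun x => x)

/-- The graph of an arrow term. Occurrences are numbered from left to right; in `Eⁱ A` the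
displayed `Eⁱ` has number `0`. -/
def Term.graph : {A B : Formula P ι} → Term A B → Fin A.count → Fin B.count
  | _, _, .id _ => fun x => x
  | _, _, .comp f g => fun x => g.graph (f.graph x)
  | _, _, .tensor f g => par f.graph g.graph
  | _, _, .app _ f => bump f.graph
  | _, _, .a _ _ _ => Fin.cast (Nat.add_assoc _ _ _)
  | _, _, .aInv _ _ _ => Fin.cast (Nat.add_assoc _ _ _).symm
  | _, _, .l _ => Fin.cast (Nat.zero_add _)
  | _, _, .lInv _ => Fin.cast (Nat.zero_add _).symm
  | _, _, .r _ => Fin.cast (Nat.add_zero _)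
  | _, _, .rInv _ => Fin.cast (Nat.add_zero _).symm
  | _, _, .c A B => swap A.count B.count
  | _, _, .nabla A => fold A.count
  | _, _, .bang _ => fun x => Fin.elim0 x

theorem par_val {m n m' n' : ℕ} (f : Fin m → Fin n) (g : Fin m' → Fin n') (x : Fin (m + m')) :
    (par f g x).val = if h : x.val < m then (f ⟨x.val, h⟩).val
      else n + (g ⟨x.val - m, by omega⟩).val := by
  refine Fin.addCases (fun x => ?_) (fun x => ?_) x
  · simp [par]
  · simp [par]

theorem bump_val {m n : ℕ} (f : Fin m → Fin n) (x : Fin (m + 1)) :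
    (bump f x).val = if h : x.val = 0 then 0 else (f ⟨x.val - 1, by omega⟩).val + 1 := by
  refine Fin.cases ?_ (fun x => ?_) x
  · simp [bump]
  · simp [bump]

theorem swap_val {m n : ℕ} (x : Fin (m + n)) :
    (swap m n x).val = if x.val < m then n + x.val else x.val - m := by
  refine Fin.addCases (fun x => ?_) (fun x => ?_) x
  · simp [swap]
  · simp [swap]

theorem fold_val {n : ℕ} (x : Fin (n + n)) :
    (fold n x).val = if x.val < n then x.val else x.val - n := by
  refine Fin.addCases (fun x => ?_) (fun x => ?_) x
  · simp [fold]
  · simp [fold, -Fin.natAdd_eq_addNat]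

theorem cast_eq_mk {m n : ℕ} (h : m = n) (x : Fin m) :
    Fin.cast h x = ⟨x.val, h ▸ x.isLt⟩ := rfl

theorem par_id {m n : ℕ} :
    par (fun x : Fin m => x) (fun x : Fin n => x) = fun x => x := by
  funext x
  apply Fin.ext
  simp only [par_val]
  grind

theorem par_comp {m n k m' n' k' : ℕ} (f : Fin m → Fin n) (g : Fin n → Fin k)
    (f' : Fin m' → Fin n') (g' : Fin n' → Fin k') :
    par (fun x => g (f x)) (fun x => g' (f' x)) = fun x => par g g' (par f f' x) := by
  funext x
  apply Fin.ext
  simp only [par_val]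
  grind

theorem bump_id {m : ℕ} :
    bump (fun x : Fin m => x) = fun x => x := by
  funext x
  apply Fin.ext
  simp only [bump_val]
  grind

theorem bump_comp {m n k : ℕ} (f : Fin m → Fin n) (g : Fin n → Fin k) :
    bump (fun x => g (f x)) = fun x => bump g (bump f x) := by
  funext x
  apply Fin.ext
  simp only [bump_val]
  grind

theorem cast_assoc_par {m n m' n' m'' n'' : ℕ} (f : Fin m → Fin n) (g : Fin m' → Fin n')
    (h : Fin m'' → Fin n'') :
    (fun x => Fin.cast (Nat.add_assoc n n' n'') (par (par f g) h x)) =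
      fun x => par f (par g h) (Fin.cast (Nat.add_assoc m m' m'') x) := by
  funext x
  apply Fin.ext
  simp only [cast_eq_mk, par_val]
  grind

theorem cast_zero_par {m n : ℕ} (f : Fin m → Fin n) :
    (fun x => Fin.cast (Nat.zero_add n) (par (fun x : Fin 0 => x) f x)) =
      fun x => f (Fin.cast (Nat.zero_add m) x) := by
  funext x
  apply Fin.ext
  simp only [cast_eq_mk, par_val]
  grind

theorem cast_par_zero {m n : ℕ} (f : Fin m → Fin n) :
    (fun x => Fin.cast (Nat.add_zero n) (par f (fun x : Fin 0 => x) x)) =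
      fun x => f (Fin.cast (Nat.add_zero m) x) := by
  funext x
  apply Fin.ext
  simp only [cast_eq_mk, par_val]
  grind

theorem cast_pentagon (m n k l : ℕ) :
    (fun x => par (fun y : Fin m => y) (Fin.cast (Nat.add_assoc n k l))
      (Fin.cast (Nat.add_assoc m (n + k) l)
        (par (Fin.cast (Nat.add_assoc m n k)) (fun y : Fin l => y) x))) =
      fun x => Fin.cast (Nat.add_assoc m n (k + l)) (Fin.cast (Nat.add_assoc (m + n) k l) x) := by
  funext x
  apply Fin.ext
  simp only [cast_eq_mk, par_val]
  grind

theorem cast_triangle (m n : ℕ) :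
    (fun x => par (fun y : Fin m => y) (Fin.cast (Nat.zero_add n))
      (Fin.cast (Nat.add_assoc m 0 n) x)) =
      par (Fin.cast (Nat.add_zero m)) (fun y : Fin n => y) := by
  funext x
  apply Fin.ext
  simp only [cast_eq_mk, par_val]
  grind

theorem swap_par {m n m' n' : ℕ} (f : Fin m → Fin n) (g : Fin m' → Fin n') :
    (fun x => swap n n' (par f g x)) = fun x => par g f (swap m m' x) := by
  funext x
  apply Fin.ext
  simp only [par_val, swap_val]
  grind

theorem swap_swap (m n : ℕ) :
    (fun x => swap n m (swap m n x)) = fun x => x := by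
  funext x
  apply Fin.ext
  simp only [swap_val]
  grind

theorem swap_hexagon (m n k : ℕ) :
    (fun x => Fin.cast (Nat.add_assoc n k m)
      (swap m (n + k) (Fin.cast (Nat.add_assoc m n k) x))) =
      fun x => par (fun y : Fin n => y) (swap m k)
        (Fin.cast (Nat.add_assoc n m k) (par (swap m n) (fun y : Fin k => y) x)) := by
  funext x
  apply Fin.ext
  simp only [cast_eq_mk, par_val, swap_val]
  grind

theorem fold_par {m n : ℕ} (f : Fin m → Fin n) :
    (fun x => fold n (par f f x)) = fun x => f (fold m x) := by
  funext x
  refine Fin.addCases (fun x => ?_) (fun x => ?_) x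
  · simp [fold, par]
  · simp [fold, par, -Fin.natAdd_eq_addNat]

theorem fold_assoc (m : ℕ) :
    (fun x => fold m (par (fold m) (fun y : Fin m => y) x)) =
      fun x => fold m (par (fun y : Fin m => y) (fold m) (Fin.cast (Nat.add_assoc m m m) x)) := by
  funext x
  apply Fin.ext
  simp only [cast_eq_mk, par_val, fold_val]
  grind

theorem fold_swap (m : ℕ) :
    (fun x => fold m (swap m m x)) = fold m := by
  funext x
  apply Fin.ext
  simp only [swap_val, fold_val]
  grind

theorem fold_add (m n : ℕ) :
    fold (m + n) = fun x => par (fold m) (fold n)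
      (Fin.cast (Nat.add_assoc m m (n + n)).symm
        (par (fun y : Fin m => y)
          (fun y => Fin.cast (Nat.add_assoc m n n)
            (par (swap n m) (fun z : Fin n => z) (Fin.cast (Nat.add_assoc n m n).symm y)))
          (Fin.cast (Nat.add_assoc m n (m + n)) x))) := by
  funext x
  apply Fin.ext
  simp only [cast_eq_mk, par_val, swap_val, fold_val]
  grind

theorem fold_neutral (m : ℕ) :
    (fun x => fold m (par (fun y : Fin m => y) (fun y : Fin 0 => Fin.elim0 y)
      (Fin.cast (Nat.add_zero m).symm x))) = fun x => x := by
  funext x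
  apply Fin.ext
  simp only [cast_eq_mk, par_val, fold_val]
  grind

/-- Equal arrow terms have the same graph. -/
theorem Eqv.graph_eq {A B : Formula P ι} {f g : Term A B} (h : Eqv f g) : f.graph = g.graph := by
  induction h with
  | refl f => rfl
  | symm _ ih => exact ih.symm
  | trans _ _ ih ih' => exact ih.trans ih'
  | comp _ _ ih ih' => simp only [Term.graph, ih, ih']
  | tensor _ _ ih ih' => exact congrArg₂ par ih ih'
  | app i _ ih => exact congrArg bump ih
  | id_comp f => rfl
  | comp_id f => rfl
  | comp_assoc f g h => rfl
  | tensor_id A B => exact par_id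
  | tensor_comp f g f' g' => exact par_comp f.graph g.graph f'.graph g'.graph
  | app_id i A => exact bump_id
  | app_comp i f g => exact bump_comp f.graph g.graph
  | a_naturality f g h => exact cast_assoc_par _ _ _
  | a_aInv A B D => rfl
  | aInv_a A B D => rfl
  | l_naturality f => exact cast_zero_par _
  | l_lInv A => rfl
  | lInv_l A => rfl
  | r_naturality f => exact cast_par_zero _
  | r_rInv A => rfl
  | rInv_r A => rfl
  | pentagon A B D F => exact cast_pentagon _ _ _ _
  | triangle A B => exact cast_triangle _ _
  | c_naturality f g => exact swap_par _ _
  | c_c A B => exact swap_swap _ _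
  | hexagon A B D => exact swap_hexagon _ _ _
  | nabla_naturality f => exact fold_par _
  | nabla_a A => exact fold_assoc _
  | nabla_l => exact funext fun x => Fin.elim0 x
  | nabla_c A => exact fold_swap _
  | nabla_ac A B => exact fold_add _ _
  | bang_unique f => exact funext fun x => Fin.elim0 x
  | nabla_bang A =>
    refine Eq.trans ?_ (fold_neutral A.count)
    have h : (Term.bang A).graph = fun y : Fin 0 => Fin.elim0 y := funext fun y => Fin.elim0 y
    funext x
    exact congrArg (fun k : Fin 0 → Fin A.count => fold A.count
      (par (fun y : Fin A.count => y) k (Fin.cast (Nat.add_zero A.count).symm x))) h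

/-- The functor `G` from `𝓓` to the category of functions between finite ordinals. -/
def graphFunctor (P : Type u) (ι : Type v) : Formula P ι ⥤ FintypeCat.Skeleton.{0} where
  obj A := FintypeCat.Skeleton.mk A.count
  map f := fun x => ULift.up
    (Quotient.lift (s := termSetoid _ _) Term.graph (fun _ _ h => Eqv.graph_eq h) f x.down)
  map_id _ := rfl
  map_comp := by rintro A B D ⟨f⟩ ⟨g⟩; rfl

end FreeCocartesian

/-! Everything rests on `A ⊗ B` being a coproduct with coprojections `inl`, `inr` and on the unit
being initial.

For an endofunctor `E`, the arrow `psi` is the copairing of `E.map (inl A B)` and `E.map (inr A B)`.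
An equation between arrows out of a tensor product may be tested on the coprojections
(`tensor_hom_ext`). There `psi` disappears and what remains is `E` applied to an equation of
coproducts. Equations between arrows out of the unit hold by initiality.

For coherence, call the letters and the subformulae `Eⁱ A'` outside the scope of every unary
connective the atoms of a formula. An arrow is determined by its restrictions to the atoms of its
source. By induction on arrow terms, each restriction lands in a single atom of the target, through
the identity of a letter or through some `Eⁱ f` (`Term.exists_atomHom`). The graph shows which atom
is hit, because such an arrow preserves the first generator and distinct atoms start at distinct
positions. It also determines the graph of `f`. Induction on the source then recovers `f`, hence the
arrow (`eq_of_homGraph_eq`). -/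

namespace CocartesianCategory

/-! ### Tensor products as coproducts -/

variable {C : Type u} [Category.{v} C] [MonoidalCategory C] [SymmetricCategory C]

/-- The middle exchange only swaps two copies of the unit, and the braiding of the unit with itself
is the identity. -/
theorem unitor_tensorμ (A B : C) :
    ((ρ_ A).inv ⊗ₘ (λ_ B).inv) ≫ tensorμ A (𝟙_ C) (𝟙_ C) B = (ρ_ A).inv ⊗ₘ (λ_ B).inv := by
  have h : (β_ (𝟙_ C) (𝟙_ C)).hom = 𝟙 _ := by
    rw [braiding_tensorUnit_left]
    monoidal
  rw [tensorμ, h]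
  monoidal

variable [CocartesianCategory C]

theorem unit_hom_ext {A : C} (f g : 𝟙_ C ⟶ A) : f = g := unitIsInitial.hom_ext f g

/-- The first coprojection `A ⟶ A ⊗ B`. -/
def inl (A B : C) : A ⟶ A ⊗ B := (ρ_ A).inv ≫ (𝟙 A ⊗ₘ bang B)

/-- The second coprojection `B ⟶ A ⊗ B`. -/
def inr (A B : C) : B ⟶ A ⊗ B := (λ_ B).inv ≫ (bang A ⊗ₘ 𝟙 B)

theorem inl_tensor {A B A' B' : C} (f : A ⟶ A') (g : B ⟶ B') :
    inl A B ≫ (f ⊗ₘ g) = f ≫ inl A' B' := by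
  have h : bang B ≫ g = bang B' := unit_hom_ext _ _
  simp only [inl, Category.assoc, tensorHom_comp_tensorHom, h, Category.id_comp]
  simp [MonoidalCategory.tensorHom_def]

theorem inr_tensor {A B A' B' : C} (f : A ⟶ A') (g : B ⟶ B') :
    inr A B ≫ (f ⊗ₘ g) = g ≫ inr A' B' := by
  have h : bang A ≫ f = bang A' := unit_hom_ext _ _
  simp only [inr, Category.assoc, tensorHom_comp_tensorHom, h, Category.id_comp]
  simp [MonoidalCategory.tensorHom_def']

theorem inl_braiding (A B : C) : inl A B ≫ (β_ A B).hom = inr B A := by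
  simp only [inl, inr, Category.assoc, BraidedCategory.braiding_naturality]
  simp

theorem inr_braiding (A B : C) : inr A B ≫ (β_ A B).hom = inl B A := by
  simp only [inl, inr, Category.assoc, BraidedCategory.braiding_naturality]
  simp

theorem inl_codiag (A : C) : inl A A ≫ codiag A = 𝟙 A := by
  rw [inl, Category.assoc]
  exact nabla_neutral A

theorem inr_codiag (A : C) : inr A A ≫ codiag A = 𝟙 A := by
  rw [← inl_braiding, Category.assoc, DisjunctiveRelevantCategory.nabla_braiding, inl_codiag]

/-- The copairing of the two coprojections is the identity; this gives uniqueness of copairings. By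
naturality the middle exchange slides past the initial arrows and acts on unit factors only, leaving
one neutrality equation for `A` and one for `B`. -/
theorem inl_tensor_inr_codiag (A B : C) : (inl A B ⊗ₘ inr A B) ≫ codiag (A ⊗ B) = 𝟙 _ := by
  rw [codiag, DisjunctiveRelevantCategory.nabla_tensor]
  have h : (inl A B ⊗ₘ inr A B) ≫ tensorμ A B A B = inl A A ⊗ₘ inr B B := by
    simp only [inl, inr, ← tensorHom_comp_tensorHom]
    rw [Category.assoc, tensorμ_natural, ← Category.assoc, unitor_tensorμ]
  rw [← Category.assoc, h, tensorHom_comp_tensorHom, inl_codiag, inr_codiag, id_tensorHom_id]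

/-- The coprojections are jointly epic. -/
theorem tensor_hom_ext {A B X : C} {f g : A ⊗ B ⟶ X} (h₁ : inl A B ≫ f = inl A B ≫ g)
    (h₂ : inr A B ≫ f = inr A B ≫ g) : f = g := by
  -- Each arrow is the copairing of its restrictions: naturality of the codiagonal pulls `k` out.
  have key (k : A ⊗ B ⟶ X) : k = ((inl A B ≫ k) ⊗ₘ (inr A B ≫ k)) ≫ codiag X := by
    rw [← tensorHom_comp_tensorHom, Category.assoc,
      DisjunctiveRelevantCategory.nabla_naturality, ← Category.assoc, inl_tensor_inr_codiag,
      Category.id_comp]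
  rw [key f, key g, h₁, h₂]

theorem inr_leftUnitor (A : C) : inr (𝟙_ C) A ≫ (λ_ A).hom = 𝟙 A := by
  have h : bang (𝟙_ C) = 𝟙 _ := unit_hom_ext _ _
  simp [inr, h]

theorem inl_rightUnitor (A : C) : inl A (𝟙_ C) ≫ (ρ_ A).hom = 𝟙 A := by
  have h : bang (𝟙_ C) = 𝟙 _ := unit_hom_ext _ _
  simp [inl, h]

/-- Initiality rewrites the arrow from the unit to `B ⊗ D` as one passing through `B`; the rest is
monoidal coherence. -/
theorem inl_inl_associator (A B D : C) :
    inl A B ≫ inl (A ⊗ B) D ≫ (α_ A B D).hom = inl A (B ⊗ D) := by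
  have h : bang (B ⊗ D) = bang B ≫ inl B D := unit_hom_ext _ _
  rw [inl, inl, inl, h, inl]
  simp only [Category.assoc, MonoidalCategory.tensorHom_def]
  monoidal

theorem inr_associator (A B D : C) :
    inr (A ⊗ B) D ≫ (α_ A B D).hom = inr B D ≫ inr A (B ⊗ D) := by
  have h : bang (A ⊗ B) = (λ_ (𝟙_ C)).inv ≫ (𝟙 _ ⊗ₘ bang B) ≫ (bang A ⊗ₘ 𝟙 _) :=
    unit_hom_ext _ _
  rw [inr, inr, inr, h]
  monoidal

theorem inr_inl_associator (A B D : C) :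
    inr A B ≫ inl (A ⊗ B) D ≫ (α_ A B D).hom = inl B D ≫ inr A (B ⊗ D) := by
  rw [← Category.assoc, ← inl_tensor (inr A B) (𝟙 D), Category.assoc, inr, inr]
  congr 1
  monoidal

/-! ### Endofunctors are disjunctive relevant -/

/-- With `inr_psi`, this characterises `psi` as a copairing; its explicit formula is not needed in
the verifications below. -/
theorem inl_psi (E : C ⥤ C) (A B : C) : inl (E.obj A) (E.obj B) ≫ psi E A B = E.map (inl A B) := by
  rw [psi, reassoc_of% @inl_tensor, inl_codiag, Category.comp_id, inl]

theorem inr_psi (E : C ⥤ C) (A B : C) : inr (E.obj A) (E.obj B) ≫ psi E A B = E.map (inr A B) := by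
  rw [psi, reassoc_of% @inr_tensor, inr_codiag, Category.comp_id, inr]

/-- Every endofunctor of a cocartesian category is lax monoidal. -/
@[reducible]
def laxMonoidal (E : C ⥤ C) : E.LaxMonoidal :=
  Functor.LaxMonoidal.ofTensorHom (psiZero E) (psi E) (by
    intro A B A' B' f g
    apply tensor_hom_ext
    · rw [reassoc_of% @inl_tensor, inl_psi, reassoc_of% @inl_psi, ← E.map_comp, ← E.map_comp, inl_tensor]
    · rw [reassoc_of% @inr_tensor, inr_psi, reassoc_of% @inr_psi, ← E.map_comp, ← E.map_comp, inr_tensor]) (by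
    intro A B D
    apply tensor_hom_ext
    · rw [reassoc_of% @inl_tensor, reassoc_of% @inl_psi]
      apply tensor_hom_ext
      · rw [reassoc_of% @inl_psi, ← E.map_comp, ← E.map_comp, inl_inl_associator,
          reassoc_of% @inl_inl_associator, reassoc_of% @inl_tensor, inl_psi]
        simp
      · rw [reassoc_of% @inr_psi, ← E.map_comp, ← E.map_comp, inr_inl_associator,
          reassoc_of% @inr_inl_associator, reassoc_of% @inr_tensor, inr_psi, reassoc_of% @inl_psi, ← E.map_comp]
    · rw [reassoc_of% @inr_tensor, reassoc_of% @inr_psi, reassoc_of% @inr_associator, reassoc_of% @inr_tensor, inr_psi,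
        reassoc_of% @inr_psi, ← E.map_comp, ← E.map_comp, inr_associator]
      simp) (by
    intro A
    apply tensor_hom_ext
    -- Both sides start at the unit, so initiality decides; the unitor is only inserted and removed.
    · exact (cancel_epi (λ_ (𝟙_ C)).hom).1 (by
        rw [← Category.assoc, ← Category.assoc]
        exact (cancel_epi (λ_ (𝟙_ C)).inv).1 (unit_hom_ext _ _))
    · rw [inr_leftUnitor, reassoc_of% @inr_tensor, reassoc_of% @inr_psi, ← E.map_comp, inr_leftUnitor]
      simp) (by
    intro A
    apply tensor_hom_ext
    · rw [inl_rightUnitor, reassoc_of% @inl_tensor, reassoc_of% @inl_psi, ← E.map_comp, inl_rightUnitor]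
      simp
    · exact unit_hom_ext _ _)

/-- Every endofunctor of a cocartesian category is disjunctive relevant. -/
@[reducible]
def disjunctiveRelevantEndofunctor (E : C ⥤ C) : DisjunctiveRelevantEndofunctor E where
  toLaxMonoidal := laxMonoidal E
  braided A B := by
    change psi E A B ≫ E.map (β_ A B).hom = (β_ (E.obj A) (E.obj B)).hom ≫ psi E B A
    apply tensor_hom_ext
    · rw [reassoc_of% @inl_psi, reassoc_of% @inl_braiding, inr_psi, ← E.map_comp, inl_braiding]
    · rw [reassoc_of% @inr_psi, reassoc_of% @inr_braiding, inl_psi, ← E.map_comp, inr_braiding]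
  map_nabla A := by
    change psi E A A ≫ E.map (codiag A) = codiag (E.obj A)
    apply tensor_hom_ext
    · rw [reassoc_of% @inl_psi, ← E.map_comp, inl_codiag, inl_codiag, E.map_id]
    · rw [reassoc_of% @inr_psi, ← E.map_comp, inr_codiag, inr_codiag, E.map_id]

end CocartesianCategory

/-! ### Graphs of the coprojections -/

namespace FreeCocartesian

open CocartesianCategory

variable {P : Type u} {ι : Type v}

/-- The graph of an arrow of `𝓓`. -/
def homGraph {A B : Formula P ι} (f : A ⟶ B) : Fin A.count → Fin B.count :=
  Quotient.lift (s := termSetoid _ _) Term.graph (fun _ _ h => Eqv.graph_eq h) f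

theorem homGraph_comp {A B D : Formula P ι} (f : A ⟶ B) (g : B ⟶ D) (x : Fin A.count) :
    homGraph (f ≫ g) x = homGraph g (homGraph f x) := by
  rcases f with ⟨f⟩
  rcases g with ⟨g⟩
  rfl

theorem homGraph_app (i : ι) {A B : Formula P ι} (f : A ⟶ B) :
    homGraph ((appFunctor i).map f) = bump (homGraph f) := by
  rcases f with ⟨f⟩
  rfl

/-- Graphs are lifted from terms, so computing one calls for an explicit representative. -/
theorem inl_eq (A B : Formula P ι) :
    inl A B = (Term.comp (.rInv A) (.tensor (.id A) (.bang B))).toHom := by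
  have h : bang B = (Term.bang B).toHom := unit_hom_ext _ _
  rw [inl, h]
  rfl

theorem inr_eq (A B : Formula P ι) :
    inr A B = (Term.comp (.lInv B) (.tensor (.bang A) (.id B))).toHom := by
  have h : bang A = (Term.bang A).toHom := unit_hom_ext _ _
  rw [inr, h]
  rfl

theorem homGraph_inl_val (A B : Formula P ι) (x : Fin A.count) :
    (homGraph (inl A B) x).val = x.val := by
  rw [inl_eq]
  refine (par_val (m := A.count) (n := A.count) (m' := 0) (n' := B.count) _ _ _).trans ?_
  exact dif_pos x.isLt

theorem homGraph_inr_val (A B : Formula P ι) (x : Fin B.count) :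
    (homGraph (inr A B) x).val = A.count + x.val := by
  rw [inr_eq]
  refine (par_val (m := 0) (n := A.count) (m' := B.count) (n' := B.count)
    (Term.bang A).graph _ _).trans ?_
  exact dif_neg (Nat.not_lt_zero _)

/-! ### Atoms and their positions -/

/-- The occurrences in a formula of the subformulae that are outside the scope of every unary
connective and are neither `I` nor a tensor product. -/
def Formula.Atoms : Formula P ι → Type
  | letter _ => Unit
  | unit => Empty
  | tensor A B => A.Atoms ⊕ B.Atoms
  | app _ _ => Unit

/-- The subformula at a given occurrence. -/
def Formula.atom : (A : Formula P ι) → A.Atoms → Formula P ι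
  | letter p, _ => letter p
  | unit, x => Empty.elim x
  | tensor A _, Sum.inl x => A.atom x
  | tensor _ B, Sum.inr x => B.atom x
  | app i A, _ => app i A

/-- The coprojection of an atom. -/
def Formula.incl : (A : Formula P ι) → (x : A.Atoms) → (A.atom x ⟶ A)
  | letter p, _ => 𝟙 (letter p)
  | unit, x => Empty.elim x
  | tensor A B, Sum.inl x => A.incl x ≫ inl A B
  | tensor A B, Sum.inr x => B.incl x ≫ inr A B
  | app i A, _ => 𝟙 (app i A)

/-- The number of generators to the left of an atom. -/
def Formula.offset : (A : Formula P ι) → A.Atoms → ℕ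
  | letter _, _ => 0
  | unit, x => Empty.elim x
  | tensor A _, Sum.inl x => A.offset x
  | tensor A B, Sum.inr x => A.count + B.offset x
  | app _ _, _ => 0

/-- The generators of an atom form a block of consecutive positions starting at its offset. -/
theorem Formula.homGraph_incl_val (A : Formula P ι) (x : A.Atoms) (k : Fin (A.atom x).count) :
    (homGraph (A.incl x) k).val = A.offset x + k.val := by
  induction A with
  | letter p => exact (Nat.zero_add _).symm
  | unit => exact Empty.elim x
  | tensor A B ihA ihB =>
    rcases x with x | x
    · refine (congrArg Fin.val (homGraph_comp (A.incl x) (inl A B) k)).trans ?_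
      rw [homGraph_inl_val]
      exact ihA x k
    · refine (congrArg Fin.val (homGraph_comp (B.incl x) (inr A B) k)).trans ?_
      rw [homGraph_inr_val]
      have := ihB x k
      change _ = A.count + B.offset x + k.val
      omega
  | app i A => exact (Nat.zero_add _).symm

/-- Every atom begins with a generator, whose image will locate the atom. -/
theorem Formula.atom_count_pos (A : Formula P ι) (x : A.Atoms) : 0 < (A.atom x).count := by
  induction A with
  | letter p => exact Nat.one_pos
  | unit => exact Empty.elim x
  | tensor A B ihA ihB =>
    rcases x with x | x
    · exact ihA x
    · exact ihB x
  | app i A => exact Nat.succ_pos _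

theorem Formula.offset_lt (A : Formula P ι) (x : A.Atoms) : A.offset x < A.count := by
  have h := A.homGraph_incl_val x ⟨0, A.atom_count_pos x⟩
  rw [← Nat.add_zero (A.offset x), ← h]
  exact Fin.isLt _

/-- In a tensor product, atoms of the left factor start before position `A.count` and those of the
right factor at or after it. So an atom is recovered from the position of its first generator. -/
theorem Formula.offset_injective (A : Formula P ι) : Function.Injective A.offset := by
  induction A with
  | letter p => exact fun _ _ _ => rfl
  | unit => exact fun x => Empty.elim x
  | tensor A B ihA ihB =>
    rintro (x | x) (y | y) h
    · exact congrArg Sum.inl (ihA h)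
    · have := A.offset_lt x
      change A.offset x = A.count + B.offset y at h
      omega
    · have := A.offset_lt y
      change A.count + B.offset x = A.offset y at h
      omega
    · exact congrArg Sum.inr (ihB (Nat.add_left_cancel h))
  | app i A => exact fun _ _ _ => rfl

/-! ### Factorisation of arrows through atoms -/

/-- Arrows between atoms that do not involve the cocartesian structure outside the scope of a
unary connective. -/
inductive AtomHom : {X Y : Formula P ι} → (X ⟶ Y) → Prop
  | letter (p : P) : AtomHom (𝟙 (Formula.letter p))
  | app (i : ι) {A B : Formula P ι} (f : A ⟶ B) :
      @AtomHom (.app i A) (.app i B) ((appFunctor i).map f)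

theorem AtomHom.id (A : Formula P ι) (x : A.Atoms) : AtomHom (𝟙 (A.atom x)) := by
  induction A with
  | letter p => exact .letter p
  | unit => exact Empty.elim x
  | tensor A B ihA ihB =>
    rcases x with x | x
    · exact ihA x
    · exact ihB x
  | app i A =>
    have h := AtomHom.app i (𝟙 A)
    rw [(appFunctor i).map_id] at h
    exact h

theorem AtomHom.comp {X Y Z : Formula P ι} {f : X ⟶ Y} {g : Y ⟶ Z} (hf : AtomHom f)
    (hg : AtomHom g) : AtomHom (f ≫ g) := by
  cases hf with
  | letter p => rwa [Category.id_comp]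
  | app i f =>
    cases hg with
    | app _ g =>
      have h := AtomHom.app i (f ≫ g)
      rw [(appFunctor i).map_comp] at h
      exact h

/-- The outermost connective `Eⁱ` is the first generator, and `bump` fixes it. -/
theorem AtomHom.homGraph_val_eq_zero {X Y : Formula P ι} {f : X ⟶ Y} (hf : AtomHom f)
    (k : Fin X.count) (hk : k.val = 0) : (homGraph f k).val = 0 := by
  cases hf with
  | letter p => exact hk
  | app i f =>
    refine (congrArg Fin.val (congrFun (homGraph_app i f) k)).trans ?_
    exact (bump_val _ _).trans (dif_pos hk)

/-- Serves the structural terms, `∇` included: they merely relocate an atom, so the arrow between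
atoms is an identity up to equality of formulae. -/
theorem exists_atomHom_of_incl_comp {A B : Formula P ι} {f : A ⟶ B} {x : A.Atoms} (y : B.Atoms)
    (hxy : ∃ e : A.atom x = B.atom y, A.incl x ≫ f = eqToHom e ≫ B.incl y) :
    ∃ (y : B.Atoms) (h : A.atom x ⟶ B.atom y), AtomHom h ∧ A.incl x ≫ f = h ≫ B.incl y := by
  obtain ⟨e, h⟩ := hxy
  refine ⟨y, eqToHom e, ?_, h⟩
  have (Y : Formula P ι) (e : A.atom x = Y) : AtomHom (eqToHom e) := by
    subst e
    exact AtomHom.id A x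
  exact this _ e

/-- Every arrow term sends an atom of its source into an atom of its target. -/
theorem Term.exists_atomHom {A B : Formula P ι} (f : Term A B) (x : A.Atoms) :
    ∃ (y : B.Atoms) (h : A.atom x ⟶ B.atom y),
      AtomHom h ∧ A.incl x ≫ f.toHom = h ≫ B.incl y := by
  induction f with
  | id A => exact ⟨x, 𝟙 _, .id A x, (Category.comp_id _).trans (Category.id_comp _).symm⟩
  | comp f g ihf ihg =>
    obtain ⟨y, h, hh, e⟩ := ihf x
    obtain ⟨z, k, hk, e'⟩ := ihg y
    refine ⟨z, h ≫ k, hh.comp hk, ?_⟩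
    change _ ≫ f.toHom ≫ g.toHom = _
    rw [← Category.assoc, e, Category.assoc, e', Category.assoc]
  | @tensor A B A' B' f g ihf ihg =>
    rcases x with x | x
    · obtain ⟨y, h, hh, e⟩ := ihf x
      refine ⟨.inl y, h, hh, ?_⟩
      change (A.incl x ≫ inl A A') ≫ (f.toHom ⊗ₘ g.toHom) = h ≫ B.incl y ≫ inl B B'
      rw [Category.assoc, inl_tensor, ← Category.assoc, e, Category.assoc]
    · obtain ⟨y, h, hh, e⟩ := ihg x
      refine ⟨.inr y, h, hh, ?_⟩
      change (A'.incl x ≫ inr A A') ≫ (f.toHom ⊗ₘ g.toHom) = h ≫ B'.incl y ≫ inr B B'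
      rw [Category.assoc, inr_tensor, ← Category.assoc, e, Category.assoc]
  | app i f =>
    -- Source and target are single atoms with identity coprojections, so the arrow is its own
    -- factorisation.
    exact ⟨(), _, .app i f.toHom, (Category.id_comp _).trans (Category.comp_id _).symm⟩
  | a A B D =>
    rcases x with (x | x) | x
    · refine exists_atomHom_of_incl_comp (.inl x) ⟨rfl, ?_⟩
      refine Eq.trans ?_ (Category.id_comp _).symm
      change ((A.incl x ≫ inl A B) ≫ inl (A ⊗ B) D) ≫ (α_ A B D).hom = A.incl x ≫ inl A (B ⊗ D)
      simp only [Category.assoc, inl_inl_associator]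
    · refine exists_atomHom_of_incl_comp (.inr (.inl x)) ⟨rfl, ?_⟩
      refine Eq.trans ?_ (Category.id_comp _).symm
      change ((B.incl x ≫ inr A B) ≫ inl (A ⊗ B) D) ≫ (α_ A B D).hom =
        (B.incl x ≫ inl B D) ≫ inr A (B ⊗ D)
      simp only [Category.assoc, inr_inl_associator]
    · refine exists_atomHom_of_incl_comp (.inr (.inr x)) ⟨rfl, ?_⟩
      refine Eq.trans ?_ (Category.id_comp _).symm
      change (D.incl x ≫ inr (A ⊗ B) D) ≫ (α_ A B D).hom = (D.incl x ≫ inr B D) ≫ inr A (B ⊗ D)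
      simp only [Category.assoc, inr_associator]
  | aInv A B D =>
    rcases x with x | x | x
    · refine exists_atomHom_of_incl_comp (.inl (.inl x)) ⟨rfl, ?_⟩
      refine Eq.trans ?_ (Category.id_comp _).symm
      change (A.incl x ≫ inl A (B ⊗ D)) ≫ (α_ A B D).inv = (A.incl x ≫ inl A B) ≫ inl (A ⊗ B) D
      rw [Iso.comp_inv_eq]
      simp only [Category.assoc, inl_inl_associator]
    · refine exists_atomHom_of_incl_comp (.inl (.inr x)) ⟨rfl, ?_⟩
      refine Eq.trans ?_ (Category.id_comp _).symm
      change ((B.incl x ≫ inl B D) ≫ inr A (B ⊗ D)) ≫ (α_ A B D).inv =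
        (B.incl x ≫ inr A B) ≫ inl (A ⊗ B) D
      rw [Iso.comp_inv_eq]
      simp only [Category.assoc, inr_inl_associator]
    · refine exists_atomHom_of_incl_comp (.inr x) ⟨rfl, ?_⟩
      refine Eq.trans ?_ (Category.id_comp _).symm
      change ((D.incl x ≫ inr B D) ≫ inr A (B ⊗ D)) ≫ (α_ A B D).inv = D.incl x ≫ inr (A ⊗ B) D
      rw [Iso.comp_inv_eq]
      simp only [Category.assoc, inr_associator]
  | l A =>
    rcases x with x | x
    · exact Empty.elim x
    · refine exists_atomHom_of_incl_comp x ⟨rfl, ?_⟩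
      refine Eq.trans ?_ (Category.id_comp _).symm
      change (A.incl x ≫ inr (𝟙_ _) A) ≫ (λ_ A).hom = A.incl x
      rw [Category.assoc, inr_leftUnitor, Category.comp_id]
  | lInv A =>
    refine exists_atomHom_of_incl_comp (.inr x) ⟨rfl, ?_⟩
    refine Eq.trans ?_ (Category.id_comp _).symm
    change A.incl x ≫ (λ_ A).inv = A.incl x ≫ inr (𝟙_ _) A
    rw [Iso.comp_inv_eq, Category.assoc, inr_leftUnitor, Category.comp_id]
  | r A =>
    rcases x with x | x
    · refine exists_atomHom_of_incl_comp x ⟨rfl, ?_⟩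
      refine Eq.trans ?_ (Category.id_comp _).symm
      change (A.incl x ≫ inl A (𝟙_ _)) ≫ (ρ_ A).hom = A.incl x
      rw [Category.assoc, inl_rightUnitor, Category.comp_id]
    · exact Empty.elim x
  | rInv A =>
    refine exists_atomHom_of_incl_comp (.inl x) ⟨rfl, ?_⟩
    refine Eq.trans ?_ (Category.id_comp _).symm
    change A.incl x ≫ (ρ_ A).inv = A.incl x ≫ inl A (𝟙_ _)
    rw [Iso.comp_inv_eq, Category.assoc, inl_rightUnitor, Category.comp_id]
  | c A B =>
    rcases x with x | x
    · refine exists_atomHom_of_incl_comp (.inr x) ⟨rfl, ?_⟩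
      refine Eq.trans ?_ (Category.id_comp _).symm
      change (A.incl x ≫ inl A B) ≫ (β_ A B).hom = A.incl x ≫ inr B A
      rw [Category.assoc, inl_braiding]
    · refine exists_atomHom_of_incl_comp (.inl x) ⟨rfl, ?_⟩
      refine Eq.trans ?_ (Category.id_comp _).symm
      change (B.incl x ≫ inr A B) ≫ (β_ A B).hom = B.incl x ≫ inl B A
      rw [Category.assoc, inr_braiding]
  | nabla A =>
    rcases x with x | x
    · refine exists_atomHom_of_incl_comp x ⟨rfl, ?_⟩
      refine Eq.trans ?_ (Category.id_comp _).symm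
      change (A.incl x ≫ inl A A) ≫ codiag A = A.incl x
      rw [Category.assoc, inl_codiag, Category.comp_id]
    · refine exists_atomHom_of_incl_comp x ⟨rfl, ?_⟩
      refine Eq.trans ?_ (Category.id_comp _).symm
      change (A.incl x ≫ inr A A) ≫ codiag A = A.incl x
      rw [Category.assoc, inr_codiag, Category.comp_id]
  | bang A => exact Empty.elim x

/-- Only existence is claimed, so passing to equivalence classes requires no compatibility with
`Eqv`. -/
theorem exists_atomHom {A B : Formula P ι} (f : A ⟶ B) (x : A.Atoms) :
    ∃ (y : B.Atoms) (h : A.atom x ⟶ B.atom y), AtomHom h ∧ A.incl x ≫ f = h ≫ B.incl y := by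
  rcases f with ⟨f⟩
  exact f.exists_atomHom x

/-! ### Faithfulness -/

/-- Lets the induction pass under a unary connective: the graph of `Eⁱ f` determines that of `f`. -/
theorem bump_injective {m n : ℕ} : Function.Injective (@bump m n) := by
  intro f g h
  funext x
  have := congrFun h x.succ
  simpa [bump] using this

/-- Arrows out of an atom with the same graph are equal as soon as the same holds for arrows
between atoms. -/
theorem comp_eq_of_homGraph_eq {A B : Formula P ι} (x : A.Atoms)
    (hA : ∀ (Y : Formula P ι) (h h' : A.atom x ⟶ Y), AtomHom h → AtomHom h' →
      homGraph h = homGraph h' → h = h')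
    (f g : A ⟶ B) (hfg : homGraph f = homGraph g) : A.incl x ≫ f = A.incl x ≫ g := by
  obtain ⟨y, h, hh, e⟩ := exists_atomHom f x
  obtain ⟨y', h', hh', e'⟩ := exists_atomHom g x
  have key (k : Fin (A.atom x).count) :
      B.offset y + (homGraph h k).val = B.offset y' + (homGraph h' k).val := by
    rw [← Formula.homGraph_incl_val, ← Formula.homGraph_incl_val, ← homGraph_comp,
      ← homGraph_comp, ← e, ← e', homGraph_comp, homGraph_comp, hfg]
  -- Evaluated at the first generator of the atom, which atom arrows preserve, `key` becomes
  -- equality of the two offsets.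
  have h₀ := key ⟨0, A.atom_count_pos x⟩
  rw [hh.homGraph_val_eq_zero _ rfl, hh'.homGraph_val_eq_zero _ rfl] at h₀
  obtain rfl := B.offset_injective h₀
  -- With the target atoms identified, cancelling the common offset in `key` equates the graphs of
  -- the two atom arrows.
  rw [e, e', hA _ h h' hh hh' (funext fun k => Fin.ext (Nat.add_left_cancel (key k)))]

/-- The induction is on the source. The target stays general because restriction to a tensor factor
keeps the whole target, while passing under `Eⁱ` replaces it by the argument of a target atom. -/
theorem eq_of_homGraph_eq {A B : Formula P ι} (f g : A ⟶ B) (hfg : homGraph f = homGraph g) :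
    f = g := by
  induction A generalizing B with
  | letter p =>
    have := comp_eq_of_homGraph_eq (A := .letter p) () (by
      intro Y h h' hh hh' _
      change Formula.letter p ⟶ Y at h h'
      -- The only atom arrow out of a letter is its identity.
      cases hh
      cases hh'
      rfl) f g hfg
    exact (Category.id_comp f).symm.trans (this.trans (Category.id_comp g))
  | unit => exact unit_hom_ext (C := Formula P ι) f g
  | tensor A A' ih ih' =>
    refine tensor_hom_ext (A := A) (B := A') (ih _ _ ?_) (ih' _ _ ?_) <;>
    · funext k
      rw [homGraph_comp, homGraph_comp]
      exact congrFun hfg _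
  | app i A ih =>
    have := comp_eq_of_homGraph_eq (A := .app i A) () (by
      intro Y h h' hh hh' e
      change Formula.app i A ⟶ Y at h h'
      cases hh with
      | app _ k =>
        cases hh' with
        | app _ k' =>
          -- Both atom arrows are `Eⁱ` of arrows out of the smaller formula `A`, so stripping `bump`
          -- makes the induction hypothesis applicable.
          have e' := (homGraph_app i k).symm.trans (e.trans (homGraph_app i k'))
          rw [ih k k' (bump_injective e')]) f g hfg
    exact (Category.id_comp f).symm.trans (this.trans (Category.id_comp g))

/-- `𝓓`-coherence. -/
theorem graphFunctor_faithful (P : Type u) (ι : Type v) : (graphFunctor P ι).Faithful where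
  map_injective {A B} f g h := by
    refine eq_of_homGraph_eq f g (funext fun k => ?_)
    exact congrArg ULift.down (congrFun h (ULift.up k))

end FreeCocartesian

theorem mainTheorem7 :
    (∀ (P : Type u) (ι : Type v), (FreeCocartesian.graphFunctor P ι).Faithful) ∧
    (∀ (C : Type u) [Category.{v} C] [MonoidalCategory C] [SymmetricCategory C]
        [CocartesianCategory C] (E : C ⥤ C),
      (∃ _ : DisjunctiveRelevantEndofunctor E,
        (∀ A B : C, Functor.LaxMonoidal.μ E A B = CocartesianCategory.psi E A B) ∧
        Functor.LaxMonoidal.ε E = CocartesianCategory.psiZero E) ∧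
      ∀ A : C, CocartesianCategory.psiZero E ≫ E.map (CocartesianCategory.bang A) =
        CocartesianCategory.bang (E.obj A)) := by
  refine ⟨FreeCocartesian.graphFunctor_faithful, fun C _ _ _ _ E => ⟨?_, fun A => ?_⟩⟩
  · exact ⟨CocartesianCategory.disjunctiveRelevantEndofunctor E, fun _ _ => rfl, rfl⟩
  · exact CocartesianCategory.unit_hom_ext _ _
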